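/- All graphs are finite and simple. For a proper edge-coloring $\sigma$ of a cubic graph and a vertex $v$, let $\sigma(v)$ be the set of colors of the edges incident to $v$. An edge $vw$ is *poor* if $|\sigma(v)\cup\sigma(w)|=3$ and *rich* if $|\sigma(v)\cup\sigma(w)|=5$; $\sigma$ is *normal* if every edge is poor or rich. A *normal $5$-coloring* is a normal proper edge-coloring with colors from a set of $5$ colors. A *snark* is a bridgeless cubic graph that is not $3$-edge-colorable. Let $B$ be the Petersen graph with two non-adjacent vertices removed, the edges at the removed vertices being kept as semiedges. Explicitly, $B$ has vertices $a,b,c,d,e,f,g,h$, edges $ab,be,bf,cd,cf,de,eg,fh,gh$, left semiedges at $a,c,g$ and right semiedges at $a,d,h$. Let $G$ be a graph and $C=u_0u_1\cdots u_{g-1}u_0$ a cycle of $G$ (indices modulo $g$). For each $i$ choose a type $\mathcal{A}_i\in\{A,A'\}$ and choose whether $\mathcal{A}_i$ has a twist. The corresponding superposition is obtained from $G$ as follows. Delete the edges of $C$, keeping all vertices and all other edges of $G$. For each $i$ add a copy $\mathcal{B}_i$ of $B$, with vertices $a_i,\dots,h_i$ and the nine edges listed above, and add the edges $u_ia_i$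 and $a_iu_{i+1}$. Then, for each $i$, add * the edges $d_{i-1}c_i$ and $h_{i-1}g_i$ if $\mathcal{A}_i$ has no twist, and the edges $d_{i-1}g_i$ and $h_{i-1}c_i$ if $\mathcal{A}_i$ has a twist; * if $\mathcal{A}_i$ is of type $A'$, moreover subdivide the two edges just added by new vertices $u_i'$ and $u_i''$, respectively, and add the edge $u_i'u_i''$. Let $\mathcal{G}_C^{\mathrm{tw}}(\mathcal{A},\mathcal{B})$ be the set of all graphs obtained in this way, over all choices of types and twists. **Corollary.** Let $G$ be a snark which admits a normal $5$-coloring and let $C$ be an even cycle in $G$. Then every $\tilde{G}^{\mathrm{tw}}\in\mathcal{G}_C^{\mathrm{tw}}(\mathcal{A},\mathcal{B})$ admits a normal $5$-coloring which has at least $18$ poor edges. -/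

import Mathlib

/-! ### Normal edge-colorings and snarks -/

/-- A proper `k`-edge-coloring of `G`: adjacent edges receive distinct colors. -/
abbrev ProperEdgeColoring {V : Type*} (G : SimpleGraph V) (k : ℕ) : Type _ :=
  G.lineGraph.Coloring (Fin k)

namespace ProperEdgeColoring

variable {V : Type*} {G : SimpleGraph V} {k : ℕ}

/-- The set `σ(v)` of the colors of the edges incident to the vertex `v`. -/
def colorsAt (σ : ProperEdgeColoring G k) (v : V) : Set (Fin k) :=
  {c | ∃ e : G.edgeSet, v ∈ (e : Sym2 V) ∧ σ e = c}

/-- For an edge `e = vw`, the set `σ(v) ∪ σ(w)`. -/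
def colorsAround (σ : ProperEdgeColoring G k) (e : G.edgeSet) : Set (Fin k) :=
  {c | ∃ v : V, v ∈ (e : Sym2 V) ∧ c ∈ colorsAt σ v}

/-- An edge `vw` is poor if `|σ(v) ∪ σ(w)| = 3`. -/
def IsPoor (σ : ProperEdgeColoring G k) (e : G.edgeSet) : Prop :=
  (colorsAround σ e).ncard = 3

/-- An edge `vw` is rich if `|σ(v) ∪ σ(w)| = 5`. -/
def IsRich (σ : ProperEdgeColoring G k) (e : G.edgeSet) : Prop :=
  (colorsAround σ e).ncard = 5

/-- A proper edge-coloring is normal if every edge is poor or rich. -/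
def IsNormal (σ : ProperEdgeColoring G k) : Prop :=
  ∀ e : G.edgeSet, IsPoor σ e ∨ IsRich σ e

end ProperEdgeColoring

/-- A snark, in the broad sense: a bridgeless cubic graph that is not `3`-edge-colorable. -/
structure IsSnark {V : Type*} [Fintype V] (G : SimpleGraph V) [DecidableRel G.Adj] : Prop where
  cubic : G.IsRegularOfDegree 3
  bridgeless : ∀ e ∈ G.edgeSet, ¬ G.IsBridge e
  not_three_edge_colorable : IsEmpty (ProperEdgeColoring G 3)

/-! ### The superedge `B`

The superedge `B` is obtained from the Petersen graph by removing two non-adjacent vertices and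
keeping the edges incident to them as semiedges. Its eight vertices are called `a, …, h`. The left
connector consists of the semiedges at `a, c, g`, the right connector of those at `a, d, h`
(the vertex `a`, the common neighbor of the two removed vertices, carries one semiedge of each
connector). -/

/-- The vertices of the superedge `B`. -/
inductive SuperedgeVertex
  | a | b | c | d | e | f | g | h
  deriving DecidableEq

instance : Fintype SuperedgeVertex :=
  ⟨{.a, .b, .c, .d, .e, .f, .g, .h}, fun x => by cases x <;> decide⟩

/-- The nine edges `ab, be, bf, cd, cf, de, eg, fh, gh` of `B`, each listed once. -/
def superedgeRel : SuperedgeVertex → SuperedgeVertex → Bool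
  | .a, .b => true
  | .b, .e => true
  | .b, .f => true
  | .c, .d => true
  | .c, .f => true
  | .d, .e => true
  | .e, .g => true
  | .f, .h => true
  | .g, .h => true
  | _, _ => false

/-- The graph on `a, …, h` formed by the edges (not the semiedges) of `B`. -/
def superedgeB : SimpleGraph SuperedgeVertex :=
  SimpleGraph.fromRel fun x y => superedgeRel x y = true

/-- `B` has two horizontal levels apart from the one of `a`: the level `false` with the vertices
`c, d` and the level `true` with the vertices `g, h`. This is the end-vertex of the left semiedge
on the given level. -/
def leftEnd : Bool → SuperedgeVertex
  | false => .c
  | true => .g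

/-- The end-vertex of the right semiedge on the given level. -/
def rightEnd : Bool → SuperedgeVertex
  | false => .d
  | true => .h

/-- The graph obtained from `B` by attaching the left semiedges to a new vertex `inr false` and the
right semiedges to a new vertex `inr true`. -/
def closedSuperedgeB : SimpleGraph (SuperedgeVertex ⊕ Bool) :=
  SimpleGraph.fromRel fun x y => match x, y with
    | .inl x, .inl y => superedgeB.Adj x y
    | .inl x, .inr false => x = .a ∨ ∃ k, x = leftEnd k
    | .inl x, .inr true => x = .a ∨ ∃ k, x = rightEnd k
    | .inr _, _ => False

/-- The Petersen graph, as the Kneser graph of the `2`-subsets of a `5`-set. -/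
def petersenGraph : SimpleGraph {s : Finset (Fin 5) // s.card = 2} :=
  SimpleGraph.fromRel fun s t => Disjoint s.1 t.1

/-- `B` is the Petersen graph with two non-adjacent vertices removed. -/
theorem closedSuperedgeB_iso_petersenGraph :
    Nonempty (closedSuperedgeB ≃g petersenGraph) ∧
      ¬ closedSuperedgeB.Adj (.inr false) (.inr true) := by
  constructor
  · let m : SuperedgeVertex ⊕ Bool → {s : Finset (Fin 5) // s.card = 2} := fun x => match x with
      | .inr false => ⟨{0, 1}, rfl⟩
      | .inr true => ⟨{0, 2}, rfl⟩
      | .inl .a => ⟨{3, 4}, rfl⟩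
      | .inl .b => ⟨{1, 2}, rfl⟩
      | .inl .c => ⟨{2, 3}, rfl⟩
      | .inl .d => ⟨{1, 4}, rfl⟩
      | .inl .e => ⟨{0, 3}, rfl⟩
      | .inl .f => ⟨{0, 4}, rfl⟩
      | .inl .g => ⟨{2, 4}, rfl⟩
      | .inl .h => ⟨{1, 3}, rfl⟩
    have hm : Function.Bijective m := by decide
    refine ⟨⟨Equiv.ofBijective m hm, ?_⟩⟩
    rintro (x | x) (y | y) <;> cases x <;> cases y <;>
      simp only [Equiv.ofBijective_apply, closedSuperedgeB, superedgeB, petersenGraph,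
        SimpleGraph.fromRel_adj, m] <;> decide
  · simp [closedSuperedgeB]

/-! ### Superpositions along a cycle -/

/-- The two kinds of supervertices. Both are cubic `7`-poles with connectors of sizes `1, 3, 3`.
`A` consists of one vertex `u` with one semiedge in each connector, together with two isolated edges
joining the two `3`-connectors. `Aprime` is obtained from `A` by subdividing the two isolated
edges by vertices `u'` and `u''` and adding the edge `u'u''`. -/
inductive SupervertexKind
  | A
  | Aprime

/-- The vertices of a superposition of a graph with vertex set `V` along a cycle
`u_0 u_1 ⋯ u_{n-1} u_0` with supervertices of the given kinds:
* `base v` for `v ∈ V`; in particular `base (u i)` is the vertex of the supervertex `𝒜_i` which has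
  a semiedge in every connector;
* `edge i x`, the vertex `x` of the superedge `ℬ_i` replacing `u_i u_{i+1}`;
* `mid i false` and `mid i true`, the vertices `u'` and `u''` of `𝒜_i`, present only if `𝒜_i` is of
  kind `Aprime`. -/
inductive SuperpositionVertex (V : Type*) (n : ℕ) (kind : ZMod n → SupervertexKind)
  | base (v : V)
  | edge (i : ZMod n) (x : SuperedgeVertex)
  | mid (i : ZMod n) (level : Bool) (h : kind i = .Aprime)

/-- The edges (each in one direction) of the superposition of `G` along the cycle
`u_0 u_1 ⋯ u_{n-1} u_0` with supervertices `𝒜_i` of the given kinds.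

Between `ℬ_i` and `ℬ_{i+1}`, the right semiedge of `ℬ_i` at `a` and the left semiedge of `ℬ_{i+1}`
at `a` are both identified with semiedges of the vertex `u_{i+1}`. The right semiedges of `ℬ_i` on
the other two levels are joined through `𝒜_{i+1}` to the left semiedges of `ℬ_{i+1}` on the same
level if `𝒜_{i+1}` has no twist, and on the opposite level if `𝒜_{i+1}` has a twist. -/
inductive SuperpositionRel {V : Type*} (G : SimpleGraph V) {n : ℕ} (u : ZMod n → V)
    (kind : ZMod n → SupervertexKind) (twist : ZMod n → Bool) :
    SuperpositionVertex V n kind → SuperpositionVertex V n kind → Prop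
  /-- The edges of `G` outside the cycle. -/
  | base {v w : V} (hG : G.Adj v w) (hC : ∀ i, s(v, w) ≠ s(u i, u (i + 1))) :
      SuperpositionRel G u kind twist (.base v) (.base w)
  /-- The edges of the superedges `ℬ_i`. -/
  | edge (i : ZMod n) {x y : SuperedgeVertex} (h : superedgeB.Adj x y) :
      SuperpositionRel G u kind twist (.edge i x) (.edge i y)
  /-- `u_i` is joined to the vertex `a` of `ℬ_i`. -/
  | start (i : ZMod n) : SuperpositionRel G u kind twist (.base (u i)) (.edge i .a)
  /-- The vertex `a` of `ℬ_i` is joined to `u_{i+1}`. -/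
  | finish (i : ZMod n) : SuperpositionRel G u kind twist (.edge i .a) (.base (u (i + 1)))
  /-- The isolated edges of a supervertex `A`. -/
  | straight (i : ZMod n) (level : Bool) (h : kind (i + 1) = .A) :
      SuperpositionRel G u kind twist (.edge i (rightEnd level))
        (.edge (i + 1) (leftEnd (xor level (twist (i + 1)))))
  /-- The semiedges of `u'` and `u''` of a supervertex `Aprime` towards the preceding superedge. -/
  | midLeft (i : ZMod n) (level : Bool) (h : kind (i + 1) = .Aprime) :
      SuperpositionRel G u kind twist (.edge i (rightEnd level)) (.mid (i + 1) level h)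
  /-- The semiedges of `u'` and `u''` of a supervertex `Aprime` towards the following superedge. -/
  | midRight (i : ZMod n) (level : Bool) (h : kind i = .Aprime) :
      SuperpositionRel G u kind twist (.mid i level h)
        (.edge i (leftEnd (xor level (twist i))))
  /-- The edge `u'u''` of a supervertex `Aprime`. -/
  | midMid (i : ZMod n) (h : kind i = .Aprime) :
      SuperpositionRel G u kind twist (.mid i false h) (.mid i true h)

/-- The superposition of `G` along the cycle `u_0 u_1 ⋯ u_{n-1} u_0`, in which the vertices of the
cycle are superposed by supervertices of the given kinds, attached with a twist where `twist` is
`true`, the edges of the cycle are superposed by `B`, and all other vertices and edges of `G` are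
superposed by themselves. -/
def superposition {V : Type*} (G : SimpleGraph V) {n : ℕ} (u : ZMod n → V)
    (kind : ZMod n → SupervertexKind) (twist : ZMod n → Bool) :
    SimpleGraph (SuperpositionVertex V n kind) :=
  SimpleGraph.fromRel (SuperpositionRel G u kind twist)

/-- The vertices `u_0, …, u_{g-1}` of a closed walk of length `g`, in their cyclic order. -/
def cycleVertex {V : Type*} {G : SimpleGraph V} {v : V} (C : G.Walk v v) (i : ZMod C.length) : V :=
  C.getVert i.val

/-!
The coloring of the superposition is pulled back from a normal coloring of `G`. Say that the cycle
has edges `u_i u_{i+1}` of color `c_i`, and that `t_i` is the color of the third edge at `u_i`, so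
that the colors at `u_i` form the set `T_i = {c_{i-1}, c_i, t_i}`. Every vertex of the superposition
is assigned a vertex of `G` (`CycleData.proj`) and gets its three colors from there. Adjacent
vertices of the superposition are assigned equal or adjacent vertices of `G`
(`CycleData.proj_eq_or_adj`), so every edge of the superposition is poor or rich, and only the
existence of a proper coloring with these color sets is in question.

The vertices of `B` are split into the paths `abfh` and `cdeg`, which are joined by the edges `be`,
`cf`, `gh`. Since the cycle is even, its vertices can be divided into odd and even ones. In `ℬ_i` one
path, the near side, uses the colors of the odd end of `u_i u_{i+1}` and the other, the far side,
those of the even end; the three joining edges have the common color `c_i`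
(`bijOn_innerColor`). Up to the automorphisms of `B`, both semiedges at the far end of `ℬ_i` (apart
from that at `a`) have one color `k ≠ c_i` of the even vertex, while those at the near end have the
color `c_i` and the color of the other edge of the cycle at the odd vertex.

* At an even vertex, both superedges use `k = t` if the supervertex is `A`. If it is `Aprime`, they
  use the two colors of the cycle, and `u'u''` has the color `t`. In both cases a twist is harmless.
* At an odd vertex `u_j`, both colors `c_{j-1}` and `c_j` occur on either side of the supervertex.
  Exchanging the levels of `ℬ_j` if necessary makes the colors agree in the case of `A` and differ in
  the case of `Aprime`.

The vertex `a` is always on the near side, so that the two colors of the cycle are exchanged at the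
odd vertices, and unchanged at the even ones. The edges of the two paths are always poor, which
gives six poor edges in every superedge, hence `18` already because a cycle has length at least `3`.
-/

open Set

/-! ### Normal colorings vertex by vertex -/

/-- A normal `5`-coloring of a cubic graph, described vertex by vertex: `f x y` is the color of the
edge `xy`, and `S x` is the set of the three colors at `x`. Since all sets `S x` have size `3`, the
edge `xy` is poor exactly if `S x = S y`. -/
structure NormalLabelling {W : Type*} (H : SimpleGraph W) (f : W → W → Fin 5)
    (S : W → Finset (Fin 5)) : Prop where
  symm : ∀ x y, H.Adj x y → f x y = f y x
  bijOn : ∀ x, BijOn (f x) (H.neighborSet x) (S x)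
  card : ∀ x, (S x).card = 3
  normal : ∀ x y, H.Adj x y → S x = S y ∨ (S x ∪ S y).card = 5

theorem exists_normalLabelling {V : Type*} [Fintype V] {G : SimpleGraph V} [DecidableRel G.Adj]
    (hG : G.IsRegularOfDegree 3) (σ : ProperEdgeColoring G 5) (hσ : σ.IsNormal) :
    ∃ f S, NormalLabelling G f S := by
  classical
  let f : V → V → Fin 5 := fun v w => if h : G.Adj v w then σ ⟨s(v, w), h⟩ else 0
  have hf : ∀ {v w} (h : G.Adj v w), f v w = σ ⟨s(v, w), h⟩ := fun h => dif_pos h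
  let S : V → Finset (Fin 5) := fun v => (G.neighborFinset v).image (f v)
  have hinj : ∀ v, InjOn (f v) (G.neighborSet v) := by
    intro v x hx y hy hxy
    rw [SimpleGraph.mem_neighborSet] at hx hy
    rw [hf hx, hf hy] at hxy
    by_contra hne
    refine σ.valid (SimpleGraph.lineGraph_adj_iff_exists.2 ⟨?_, v, ?_, ?_⟩) hxy
    · intro h
      exact hne (Sym2.congr_right.1 (congrArg Subtype.val h))
    · simp
    · simp
  have hcard : ∀ v, (S v).card = 3 := by
    intro v
    rw [Finset.card_image_of_injOn (by simpa using hinj v), SimpleGraph.card_neighborFinset_eq_degree,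
      hG v]
  have hS : ∀ v, σ.colorsAt v = S v := by
    intro v
    ext c
    simp only [ProperEdgeColoring.colorsAt, mem_ofPred_eq, S, Finset.coe_image, mem_image,
      Finset.mem_coe, SimpleGraph.mem_neighborFinset]
    constructor
    · rintro ⟨⟨e, he⟩, hv, rfl⟩
      obtain ⟨w, rfl⟩ := Sym2.mem_iff_exists.1 hv
      exact ⟨w, he, hf he⟩
    · rintro ⟨w, hw, rfl⟩
      exact ⟨⟨s(v, w), hw⟩, by simp, (hf hw).symm⟩
  refine ⟨f, S, ?_, ?_, hcard, ?_⟩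
  · intro x y h
    rw [hf h, hf h.symm]
    congr 2
    exact Sym2.eq_swap
  · intro v
    have h := (hinj v).bijOn_image
    simpa [S] using h
  · intro x y h
    have hU : σ.colorsAround ⟨s(x, y), h⟩ = ((S x ∪ S y : Finset (Fin 5)) : Set (Fin 5)) := by
      ext c
      simp [ProperEdgeColoring.colorsAround, hS]
    rcases hσ ⟨s(x, y), h⟩ with h3 | h5
    · left
      rw [ProperEdgeColoring.IsPoor, hU, ncard_coe_finset] at h3
      have h1 := Finset.eq_of_subset_of_card_le (Finset.subset_union_left (s₁ := S x) (s₂ := S y))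
        (by rw [h3, hcard])
      have h2 := Finset.eq_of_subset_of_card_le (Finset.subset_union_right (s₁ := S x) (s₂ := S y))
        (by rw [h3, hcard])
      exact h1.trans h2.symm
    · right
      rwa [ProperEdgeColoring.IsRich, hU, ncard_coe_finset] at h5

theorem NormalLabelling.exists_coloring {W : Type*} {H : SimpleGraph W} {f : W → W → Fin 5}
    {S : W → Finset (Fin 5)} (h : NormalLabelling H f S) :
    ∃ τ : ProperEdgeColoring H 5, τ.IsNormal ∧
      ∀ x y (hxy : H.Adj x y), S x = S y → τ.IsPoor ⟨s(x, y), hxy⟩ := by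
  -- The orientation of each edge is arbitrary, `f` being symmetric on adjacent vertices.
  let col : H.edgeSet → Fin 5 := fun e => f (Quot.out (e : Sym2 W)).1 (Quot.out (e : Sym2 W)).2
  have hcol : ∀ {x y} (hxy : H.Adj x y), col ⟨s(x, y), hxy⟩ = f x y := by
    intro x y hxy
    have hq : s((Quot.out s(x, y)).1, (Quot.out s(x, y)).2) = s(x, y) := Quot.out_eq s(x, y)
    simp only [col]
    rcases Sym2.eq_iff.1 hq with ⟨h1, h2⟩ | ⟨h1, h2⟩
    · rw [h1, h2]
    · rw [h1, h2, h.symm x y hxy]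
  let τ : ProperEdgeColoring H 5 := SimpleGraph.Coloring.mk col (by
    rintro ⟨e, he⟩ ⟨e', he'⟩ hadj heq
    obtain ⟨hne, v, hv, hv'⟩ := SimpleGraph.lineGraph_adj_iff_exists.1 hadj
    obtain ⟨x, rfl⟩ := Sym2.mem_iff_exists.1 hv
    obtain ⟨y, rfl⟩ := Sym2.mem_iff_exists.1 hv'
    rw [hcol he, hcol he'] at heq
    obtain rfl : x = y := (h.bijOn v).injOn he he' heq
    exact hne rfl)
  have hτ : ∀ {x y} (hxy : H.Adj x y), τ ⟨s(x, y), hxy⟩ = f x y := hcol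
  have hS : ∀ x, τ.colorsAt x = S x := by
    intro x
    rw [← (h.bijOn x).image_eq]
    ext c
    simp only [ProperEdgeColoring.colorsAt, mem_ofPred_eq, mem_image, SimpleGraph.mem_neighborSet]
    constructor
    · rintro ⟨⟨e, he⟩, hv, rfl⟩
      obtain ⟨w, rfl⟩ := Sym2.mem_iff_exists.1 hv
      exact ⟨w, he, (hτ he).symm⟩
    · rintro ⟨w, hw, rfl⟩
      exact ⟨⟨s(x, w), hw⟩, by simp, hτ hw⟩
  have hU : ∀ x y (hxy : H.Adj x y),
      τ.colorsAround ⟨s(x, y), hxy⟩ = ((S x ∪ S y : Finset (Fin 5)) : Set (Fin 5)) := by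
    intro x y hxy
    ext c
    simp [ProperEdgeColoring.colorsAround, hS]
  have hpoor : ∀ x y (hxy : H.Adj x y), S x = S y → τ.IsPoor ⟨s(x, y), hxy⟩ := by
    intro x y hxy hs
    rw [ProperEdgeColoring.IsPoor, hU, ncard_coe_finset, hs, Finset.union_idempotent, h.card]
  refine ⟨τ, ?_, hpoor⟩
  rintro ⟨e, he⟩
  induction e using Sym2.ind with
  | _ x y =>
    rcases h.normal x y he with hs | h5
    · exact Or.inl (hpoor x y he hs)
    · right
      rw [ProperEdgeColoring.IsRich]
      exact (congrArg ncard (hU x y he)).trans ((ncard_coe_finset _).trans h5)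

/-! ### The coloring of a superedge -/

namespace SuperedgeVertex

/-- The left-right reflection of `B`. -/
def reflect : SuperedgeVertex → SuperedgeVertex
  | a => a
  | b => b
  | c => d
  | d => c
  | e => f
  | f => e
  | g => h
  | h => g

/-- The automorphism of `B` exchanging the two levels. -/
def swapLevels : SuperedgeVertex → SuperedgeVertex
  | a => a
  | b => b
  | c => g
  | d => h
  | e => f
  | f => e
  | g => c
  | h => d

/-- The automorphism of `B` that reflects if `o` holds and exchanges the levels if `s` holds. -/
def twistBy (o s : Bool) (x : SuperedgeVertex) : SuperedgeVertex :=
  (bif o then reflect else id) ((bif s then swapLevels else id) x)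

/-- The near side of `B` is the path `abfh`; the other vertices form the far side, the path `cdeg`.
The edges between the two sides are `be`, `cf`, `gh`. -/
def isNear : SuperedgeVertex → Bool
  | a | b | f | h => true
  | c | d | e | g => false

/-- The coloring of the edges of `B` with the colors `x`, `y`, `z` at the vertices of the near side
and `x`, `k`, `l` at those of the far side. -/
def innerColor {K : Type*} (x y z k l : K) : SuperedgeVertex → SuperedgeVertex → K
  | a, b => z
  | b, a => z
  | b, f => y
  | f, b => y
  | f, h => z
  | h, f => z
  | c, d => l
  | d, c => l
  | d, e => k
  | e, d => k
  | e, g => l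
  | g, e => l
  | _, _ => x

/-- The colors of the semiedges of `B` at `c, d, g, h` that complete `innerColor`. -/
def semiColor {K : Type*} (x y k : K) : SuperedgeVertex → K
  | c => k
  | g => k
  | h => y
  | _ => x

/-- The set of the colors of the semiedges of `B` at a given vertex that complete `innerColor`. -/
def outerColors {K : Type*} (x y k : K) : SuperedgeVertex → Set K
  | a => {x, y}
  | b => ∅
  | e => ∅
  | f => ∅
  | v => {semiColor x y k v}

end SuperedgeVertex

open SuperedgeVertex

instance : DecidableRel superedgeB.Adj := fun x y => by
  unfold superedgeB
  rw [SimpleGraph.fromRel_adj]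
  infer_instance

theorem innerColor_comm {K : Type*} (x y z k l : K) (v w : SuperedgeVertex) :
    innerColor x y z k l v w = innerColor x y z k l w v := by
  cases v <;> cases w <;> rfl

theorem twistBy_twistBy (o s : Bool) (x : SuperedgeVertex) : twistBy o s (twistBy o s x) = x := by
  revert o s x; decide

theorem twistBy_adj (o s : Bool) (x y : SuperedgeVertex) :
    superedgeB.Adj (twistBy o s x) (twistBy o s y) ↔ superedgeB.Adj x y := by
  revert o s x y; decide

theorem bijOn_triple {α β : Type*} {f : α → β} {p q r : α} {x y z : β} (hp : f p = x)
    (hq : f q = y) (hr : f r = z) (hxy : x ≠ y) (hxz : x ≠ z) (hyz : y ≠ z) :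
    BijOn f {p, q, r} {x, y, z} := by
  subst hp hq hr
  have h : InjOn f {p, q, r} := by
    rintro s (rfl | rfl | rfl) t (rfl | rfl | rfl) hst <;> first | rfl | exact absurd hst ‹_› |
      exact absurd hst.symm ‹_›
  simpa [image_insert_eq] using h.bijOn_image

theorem bijOn_pair {α β : Type*} {f : α → β} {p q : α} {x y : β} (hp : f p = x)
    (hq : f q = y) (hxy : x ≠ y) : BijOn f {p, q} {x, y} := by
  subst hp hq
  have h : InjOn f {p, q} := by
    rintro s (rfl | rfl) t (rfl | rfl) hst <;> first | rfl | exact absurd hst ‹_› |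
      exact absurd hst.symm ‹_›
  simpa [image_insert_eq] using h.bijOn_image

/-- At every vertex, `innerColor` and `outerColors` together use each color of the side of that
vertex exactly once. -/
theorem bijOn_innerColor {K : Type*} {x y z k l : K} (hxy : x ≠ y) (hxz : x ≠ z) (hyz : y ≠ z)
    (hxk : x ≠ k) (hxl : x ≠ l) (hkl : k ≠ l) (v : SuperedgeVertex) :
    BijOn (innerColor x y z k l v) (superedgeB.neighborSet v)
      ((bif isNear v then {x, y, z} else {x, k, l}) \ outerColors x y k v) := by
  have hN : ∀ s : Finset SuperedgeVertex, (∀ w, superedgeB.Adj v w ↔ w ∈ s) →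
      superedgeB.neighborSet v = s := fun s hs => by ext w; simpa using hs w
  cases v
  · have hT : ({x, y, z} : Set K) \ {x, y} = {z} := by grind
    rw [hN {.b} (by decide)]
    simp only [Finset.coe_singleton]
    change BijOn _ _ (({x, y, z} : Set K) \ {x, y})
    rw [hT]
    exact bijOn_singleton.2 rfl
  · have hT : ({x, y, z} : Set K) \ ∅ = {z, x, y} := by grind
    rw [hN {.a, .e, .f} (by decide)]
    simp only [Finset.coe_insert, Finset.coe_singleton]
    change BijOn _ _ (({x, y, z} : Set K) \ ∅)
    rw [hT]
    exact bijOn_triple rfl rfl rfl hxz.symm hyz.symm hxy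
  · have hT : ({x, k, l} : Set K) \ {k} = {l, x} := by grind
    rw [hN {.d, .f} (by decide)]
    simp only [Finset.coe_insert, Finset.coe_singleton]
    change BijOn _ _ (({x, k, l} : Set K) \ {k})
    rw [hT]
    exact bijOn_pair rfl rfl hxl.symm
  · have hT : ({x, k, l} : Set K) \ {x} = {l, k} := by grind
    rw [hN {.c, .e} (by decide)]
    simp only [Finset.coe_insert, Finset.coe_singleton]
    change BijOn _ _ (({x, k, l} : Set K) \ {x})
    rw [hT]
    exact bijOn_pair rfl rfl hkl.symm
  · have hT : ({x, k, l} : Set K) \ ∅ = {x, k, l} := by grind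
    rw [hN {.b, .d, .g} (by decide)]
    simp only [Finset.coe_insert, Finset.coe_singleton]
    change BijOn _ _ (({x, k, l} : Set K) \ ∅)
    rw [hT]
    exact bijOn_triple rfl rfl rfl hxk hxl hkl
  · have hT : ({x, y, z} : Set K) \ ∅ = {x, y, z} := by grind
    rw [hN {.c, .b, .h} (by decide)]
    simp only [Finset.coe_insert, Finset.coe_singleton]
    change BijOn _ _ (({x, y, z} : Set K) \ ∅)
    rw [hT]
    exact bijOn_triple rfl rfl rfl hxy hxz hyz
  · have hT : ({x, k, l} : Set K) \ {k} = {l, x} := by grind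
    rw [hN {.e, .h} (by decide)]
    simp only [Finset.coe_insert, Finset.coe_singleton]
    change BijOn _ _ (({x, k, l} : Set K) \ {k})
    rw [hT]
    exact bijOn_pair rfl rfl hxl.symm
  · have hT : ({x, y, z} : Set K) \ {y} = {z, x} := by grind
    rw [hN {.f, .g} (by decide)]
    simp only [Finset.coe_insert, Finset.coe_singleton]
    change BijOn _ _ (({x, y, z} : Set K) \ {y})
    rw [hT]
    exact bijOn_pair rfl rfl hxz.symm

theorem bijOn_innerColor_twistBy {K : Type*} {x y z k l : K} (hxy : x ≠ y) (hxz : x ≠ z)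
    (hyz : y ≠ z) (hxk : x ≠ k) (hxl : x ≠ l) (hkl : k ≠ l) (o s : Bool) (v : SuperedgeVertex) :
    BijOn (fun w => innerColor x y z k l (twistBy o s v) (twistBy o s w)) (superedgeB.neighborSet v)
      ((bif isNear (twistBy o s v) then {x, y, z} else {x, k, l}) \
        outerColors x y k (twistBy o s v)) := by
  refine (bijOn_innerColor hxy hxz hyz hxk hxl hkl (twistBy o s v)).comp ⟨?_, ?_, ?_⟩
  · exact fun w hw => (twistBy_adj o s v w).2 hw
  · exact (Function.LeftInverse.injective (twistBy_twistBy o s)).injOn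
  · intro w hw
    refine ⟨twistBy o s w, ?_, twistBy_twistBy o s w⟩
    rw [SimpleGraph.mem_neighborSet, ← twistBy_adj o s, twistBy_twistBy]
    exact hw

/-- The edges of `B` with both ends on the same side. -/
def sideEdge : Fin 6 → SuperedgeVertex × SuperedgeVertex :=
  ![(.a, .b), (.b, .f), (.f, .h), (.c, .d), (.d, .e), (.e, .g)]

theorem sideEdge_adj (j : Fin 6) : superedgeB.Adj (sideEdge j).1 (sideEdge j).2 := by
  revert j; decide

theorem isNear_sideEdge (j : Fin 6) : isNear (sideEdge j).1 = isNear (sideEdge j).2 := by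
  revert j; decide

theorem sideEdge_injective : Function.Injective fun j => s((sideEdge j).1, (sideEdge j).2) := by
  decide

/-! ### Adjacency in a superposition -/

namespace Superposition

variable {V : Type*} {G : SimpleGraph V} {n : ℕ} {u : ZMod n → V} {kind : ZMod n → SupervertexKind}
  {twist : ZMod n → Bool}

open SuperpositionVertex

/-- The neighbor across the supervertex `𝒜_{i+1}` of the right end of `ℬ_i` on a given level. -/
def rightNeighbor (V : Type*) (kind : ZMod n → SupervertexKind) (twist : ZMod n → Bool)
    (i : ZMod n) (level : Bool) : SuperpositionVertex V n kind :=
  match h : kind (i + 1) with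
  | .A => edge (i + 1) (leftEnd (xor level (twist (i + 1))))
  | .Aprime => mid (i + 1) level h

/-- The neighbor across the supervertex `𝒜_i` of the left end of `ℬ_i` on a given level. -/
def leftNeighbor (V : Type*) (kind : ZMod n → SupervertexKind) (twist : ZMod n → Bool)
    (i : ZMod n) (level : Bool) : SuperpositionVertex V n kind :=
  match h : kind i with
  | .A => edge (i - 1) (rightEnd (xor level (twist i)))
  | .Aprime => mid i (xor level (twist i)) h

/-- The neighbors of the vertex `x` of `ℬ_i` outside `ℬ_i`. -/
def outerNeighbors (u : ZMod n → V) (kind : ZMod n → SupervertexKind) (twist : ZMod n → Bool)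
    (i : ZMod n) : SuperedgeVertex → Set (SuperpositionVertex V n kind)
  | .a => {base (u i), base (u (i + 1))}
  | .b => ∅
  | .c => {leftNeighbor V kind twist i false}
  | .d => {rightNeighbor V kind twist i false}
  | .e => ∅
  | .f => ∅
  | .g => {leftNeighbor V kind twist i true}
  | .h => {rightNeighbor V kind twist i true}

theorem rightNeighbor_of_A {i : ZMod n} (h : kind (i + 1) = .A) (level : Bool) :
    rightNeighbor V kind twist i level = edge (i + 1) (leftEnd (xor level (twist (i + 1)))) := by
  unfold rightNeighbor
  split <;> simp_all

theorem rightNeighbor_of_Aprime {i : ZMod n} (h : kind (i + 1) = .Aprime) (level : Bool) :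
    rightNeighbor V kind twist i level = mid (i + 1) level h := by
  unfold rightNeighbor
  split <;> simp_all

theorem leftNeighbor_of_A {i : ZMod n} (h : kind i = .A) (level : Bool) :
    leftNeighbor V kind twist i level = edge (i - 1) (rightEnd (xor level (twist i))) := by
  unfold leftNeighbor
  split <;> simp_all

theorem leftNeighbor_of_Aprime {i : ZMod n} (h : kind i = .Aprime) (level : Bool) :
    leftNeighbor V kind twist i level = mid i (xor level (twist i)) h := by
  unfold leftNeighbor
  split <;> simp_all

theorem rel_irrefl (x : SuperpositionVertex V n kind) : ¬ SuperpositionRel G u kind twist x x := by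
  intro h
  generalize hy : x = y at h
  have h' : SuperpositionRel G u kind twist y x := hy ▸ h
  clear h
  cases h' with
  | base hG hC => cases hy; exact hG.ne rfl
  | edge i h => cases hy; exact h.ne rfl
  | start i => cases hy
  | finish i => cases hy
  | straight i level h =>
    generalize xor level (twist (i + 1)) = l at hy
    have h2 := (SuperpositionVertex.edge.inj hy).2
    revert h2
    cases level <;> cases l <;> simp [leftEnd, rightEnd]
  | midLeft i level h => cases hy
  | midRight i level h => cases hy
  | midMid i h => cases hy

theorem adj_iff {x y : SuperpositionVertex V n kind} :
    (superposition G u kind twist).Adj x y ↔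
      SuperpositionRel G u kind twist x y ∨ SuperpositionRel G u kind twist y x := by
  rw [superposition, SimpleGraph.fromRel_adj]
  refine ⟨And.right, fun h => ⟨?_, h⟩⟩
  rintro rfl
  exact rel_irrefl x (h.elim id id)

theorem neighborSet_edge (i : ZMod n) (x : SuperedgeVertex) :
    (superposition G u kind twist).neighborSet (edge i x) =
      edge i '' superedgeB.neighborSet x ∪ outerNeighbors u kind twist i x := by
  ext y
  rw [SimpleGraph.mem_neighborSet, adj_iff]
  constructor
  · generalize hz : (edge i x : SuperpositionVertex V n kind) = z
    rintro (h | h)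
    · cases h with
      | base hG hC => cases hz
      | edge j h => cases hz; exact Or.inl ⟨_, h, rfl⟩
      | start j => cases hz
      | finish j => cases hz; exact Or.inr (Or.inr rfl)
      | straight j level h =>
        cases hz
        right
        cases level <;> simp [outerNeighbors, rightEnd, rightNeighbor_of_A h]
      | midLeft j level h =>
        cases hz
        right
        cases level <;> simp [outerNeighbors, rightEnd, rightNeighbor_of_Aprime h]
      | midRight j level h => cases hz
      | midMid j h => cases hz
    · cases h with
      | base hG hC => cases hz
      | edge j h => cases hz; exact Or.inl ⟨_, h.symm, rfl⟩
      | start j => cases hz; exact Or.inr (Or.inl rfl)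
      | finish j => cases hz
      | straight j level h =>
        obtain ⟨rfl, rfl⟩ := SuperpositionVertex.edge.inj hz
        right
        rcases htw : twist (j + 1) <;> cases level <;>
          simp [outerNeighbors, leftEnd, leftNeighbor_of_A h, htw]
      | midLeft j level h => cases hz
      | midRight j level h =>
        obtain ⟨rfl, rfl⟩ := SuperpositionVertex.edge.inj hz
        right
        rcases htw : twist i <;> cases level <;>
          simp [outerNeighbors, leftEnd, leftNeighbor_of_Aprime h, htw]
      | midMid j h => cases hz
  · have hright : ∀ level, SuperpositionRel G u kind twist (edge i (rightEnd level))
        (rightNeighbor V kind twist i level) := by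
      intro level
      rcases h : kind (i + 1)
      · rw [rightNeighbor_of_A h]
        exact .straight i level h
      · rw [rightNeighbor_of_Aprime h]
        exact .midLeft i level h
    have hleft : ∀ level, SuperpositionRel G u kind twist
        (leftNeighbor V kind twist i level) (edge i (leftEnd level)) := by
      intro level
      rcases h : kind i
      · rw [leftNeighbor_of_A h]
        obtain ⟨j, rfl⟩ : ∃ j, i = j + 1 := ⟨i - 1, by simp⟩
        have := SuperpositionRel.straight (G := G) (u := u) (twist := twist) j
          (xor level (twist (j + 1))) h
        simpa [Bool.xor_assoc] using this
      · rw [leftNeighbor_of_Aprime h]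
        have := SuperpositionRel.midRight (G := G) (u := u) (twist := twist) i
          (xor level (twist i)) h
        simpa [Bool.xor_assoc] using this
    rintro (⟨x', hx', rfl⟩ | h)
    · exact Or.inl (.edge i hx')
    · cases x with
      | a =>
        rcases h with rfl | rfl
        · exact Or.inr (.start i)
        · exact Or.inl (.finish i)
      | b => exact h.elim
      | e => exact h.elim
      | f => exact h.elim
      | c => rw [mem_singleton_iff.1 h]; exact Or.inr (hleft false)
      | g => rw [mem_singleton_iff.1 h]; exact Or.inr (hleft true)
      | d => rw [mem_singleton_iff.1 h]; exact Or.inl (hright false)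
      | h => rw [mem_singleton_iff.1 h]; exact Or.inl (hright true)

theorem neighborSet_mid (i : ZMod n) (level : Bool) (h : kind i = .Aprime) :
    (superposition G u kind twist).neighborSet (mid i level h) =
      {edge (i - 1) (rightEnd level), edge i (leftEnd (xor level (twist i))),
        mid i (!level) h} := by
  ext y
  rw [SimpleGraph.mem_neighborSet, adj_iff]
  constructor
  · generalize hz : (mid i level h : SuperpositionVertex V n kind) = z
    rintro (h' | h')
    · cases h' <;> cases hz <;> simp
    · cases h' with
      | midLeft j level h' =>
        obtain ⟨rfl, rfl⟩ := SuperpositionVertex.mid.inj hz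
        simp
      | _ => cases hz <;> simp
  · rintro (rfl | rfl | rfl)
    · obtain ⟨j, rfl⟩ : ∃ j, i = j + 1 := ⟨i - 1, by simp⟩
      right
      simpa using SuperpositionRel.midLeft j level h
    · exact Or.inl (.midRight i level h)
    · cases level
      · exact Or.inl (.midMid i h)
      · exact Or.inr (.midMid i h)

theorem neighborSet_base_of_notMem {v : V} (hv : v ∉ range u) :
    (superposition G u kind twist).neighborSet (base v) = base '' G.neighborSet v := by
  ext y
  rw [SimpleGraph.mem_neighborSet, adj_iff]
  constructor
  · generalize hz : (base v : SuperpositionVertex V n kind) = z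
    rintro (h | h)
    · cases h with
      | base hG hC => cases hz; exact ⟨_, hG, rfl⟩
      | start i => cases hz; exact absurd ⟨_, rfl⟩ hv
      | _ => cases hz
    · cases h with
      | base hG hC => cases hz; exact ⟨_, hG.symm, rfl⟩
      | finish i => cases hz; exact absurd ⟨_, rfl⟩ hv
      | _ => cases hz
  · rintro ⟨w, hw, rfl⟩
    refine Or.inl (.base hw fun i hi => hv ?_)
    rcases Sym2.eq_iff.1 hi with ⟨rfl, -⟩ | ⟨rfl, -⟩ <;> exact ⟨_, rfl⟩

theorem neighborSet_base_cycle (hu : Function.Injective u) (i : ZMod n) {w : V}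
    (hN : G.neighborSet (u (i + 1)) = {u i, u (i + 1 + 1), w}) (h1 : w ≠ u i)
    (h2 : w ≠ u (i + 1 + 1)) :
    (superposition G u kind twist).neighborSet (base (u (i + 1))) =
      {edge i .a, edge (i + 1) .a, base w} := by
  have hw : ∀ x, G.Adj (u (i + 1)) x → (∀ j, s(u (i + 1), x) ≠ s(u j, u (j + 1))) → x = w := by
    intro x hx hC
    have hx' : x ∈ G.neighborSet (u (i + 1)) := hx
    rw [hN] at hx'
    rcases hx' with rfl | rfl | rfl
    · exact absurd Sym2.eq_swap (hC i)
    · exact absurd rfl (hC (i + 1))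
    · rfl
  ext y
  rw [SimpleGraph.mem_neighborSet, adj_iff]
  constructor
  · generalize hz : (base (u (i + 1)) : SuperpositionVertex V n kind) = z
    rintro (h | h)
    · cases h with
      | base hG hC => cases hz; rw [hw _ hG hC]; simp
      | start j => rw [← hu (SuperpositionVertex.base.inj hz)]; simp
      | _ => cases hz
    · cases h with
      | base hG hC =>
        cases hz
        rw [hw _ hG.symm fun j => by rw [Sym2.eq_swap]; exact hC j]
        simp
      | finish j =>
        rw [← add_right_cancel (hu (SuperpositionVertex.base.inj hz))]
        simp
      | _ => cases hz
  · rintro (rfl | rfl | rfl)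
    · exact Or.inr (.finish i)
    · exact Or.inl (.start (i + 1))
    · refine Or.inl (.base ?_ fun j hj => ?_)
      · have : w ∈ G.neighborSet (u (i + 1)) := by rw [hN]; simp
        exact this
      · rcases Sym2.eq_iff.1 hj with ⟨h, h'⟩ | ⟨h, h'⟩
        · rw [← hu h] at h'
          exact h2 h'
        · rw [← add_right_cancel (hu h)] at h'
          exact h1 h'

end Superposition

/-! ### The coloring along the cycle -/

/-- The data on which the coloring of the superedges depends: the color `c i` of the edge
`u_i u_{i+1}`, the color `t i` of the third edge at `u_i`, the parity `par i` of `i` (`true` if `i` is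
odd), and the kinds and twists of the supervertices. -/
structure CycleData (n : ℕ) where
  c : ZMod n → Fin 5
  t : ZMod n → Fin 5
  par : ZMod n → Bool
  kind : ZMod n → SupervertexKind
  twist : ZMod n → Bool

namespace CycleData

variable {n : ℕ} (D : CycleData n)

/-- The index of the odd end of `u_i u_{i+1}`, whose colors are used on the near side of `ℬ_i`. -/
def near (i : ZMod n) : ZMod n := bif D.par i then i else i + 1

/-- The index of the even end of `u_i u_{i+1}`, whose colors are used on the far side of `ℬ_i`. -/
def far (i : ZMod n) : ZMod n := bif D.par i then i + 1 else i

/-- The color of the other edge of the cycle at the near end of `u_i u_{i+1}`. -/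
def nearColor (i : ZMod n) : Fin 5 := bif D.par i then D.c (i - 1) else D.c (i + 1)

/-- The color of the other edge of the cycle at the far end of `u_i u_{i+1}`. -/
def farColor (i : ZMod n) : Fin 5 := bif D.par i then D.c (i + 1) else D.c (i - 1)

/-- The color of the two semiedges of `ℬ_i` at its far end other than that at `a`. Both edges of a
far supervertex `A` get the color `t`. In `Aprime` this is the color of `u'u''`, so that the two
adjacent superedges have to use the two colors of the cycle. -/
def k (i : ZMod n) : Fin 5 :=
  match D.kind (D.far i) with
  | .A => D.t (D.far i)
  | .Aprime => D.farColor i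

/-- The color at the far end of `u_i u_{i+1}` other than `c i` and `k i`. -/
def l (i : ZMod n) : Fin 5 :=
  match D.kind (D.far i) with
  | .A => D.farColor i
  | .Aprime => D.t (D.far i)

/-- Whether the levels of `ℬ_i` are exchanged. For odd `i` this is chosen such that the colors of
`ℬ_{i-1}` and `ℬ_i` fit together across `𝒜_i`. -/
def flip (i : ZMod n) : Bool :=
  D.par i && match D.kind i with
    | .A => !D.twist i
    | .Aprime => D.twist i

/-- The automorphism of `B` that takes the position of `ℬ_i` to the one in which the far end is on
the left and the levels are not exchanged. -/
def place (i : ZMod n) : SuperedgeVertex → SuperedgeVertex := twistBy (D.par i) (D.flip i)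

/-- The coloring of the edges of `ℬ_i`. -/
def inner (i : ZMod n) (x y : SuperedgeVertex) : Fin 5 :=
  innerColor (D.c i) (D.nearColor i) (D.t (D.near i)) (D.k i) (D.l i) (D.place i x) (D.place i y)

/-- The colors of the semiedges of `ℬ_i` at `c, d, g, h`. -/
def semi (i : ZMod n) (x : SuperedgeVertex) : Fin 5 :=
  semiColor (D.c i) (D.nearColor i) (D.k i) (D.place i x)

/-- The index of the vertex of the cycle whose colors are used at the vertex `x` of `ℬ_i`. -/
def side (i : ZMod n) (x : SuperedgeVertex) : ZMod n :=
  bif isNear (D.place i x) then D.near i else D.far i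

/-- The colors at `u_j`. -/
def colors (j : ZMod n) : Set (Fin 5) := {D.c (j - 1), D.c j, D.t j}

/-- The colors at each vertex of the cycle are distinct. -/
def IsProper : Prop :=
  ∀ i, D.c i ≠ D.c (i + 1) ∧ D.c i ≠ D.t (i + 1) ∧ D.c (i + 1) ≠ D.t (i + 1)

variable {D}

theorem IsProper.sub_one (hD : D.IsProper) (i : ZMod n) :
    D.c (i - 1) ≠ D.c i ∧ D.c (i - 1) ≠ D.t i ∧ D.c i ≠ D.t i := by
  simpa using hD (i - 1)

theorem IsProper.near_distinct (hD : D.IsProper) (i : ZMod n) :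
    D.c i ≠ D.nearColor i ∧ D.c i ≠ D.t (D.near i) ∧ D.nearColor i ≠ D.t (D.near i) := by
  have h1 := hD i
  have h2 := hD.sub_one i
  unfold nearColor near
  rcases D.par i
  · exact h1
  · exact ⟨h2.1.symm, h2.2.2, h2.2.1⟩

theorem IsProper.far_distinct (hD : D.IsProper) (i : ZMod n) :
    D.c i ≠ D.k i ∧ D.c i ≠ D.l i ∧ D.k i ≠ D.l i := by
  have h1 := hD i
  have h2 := hD.sub_one i
  unfold k l farColor far
  rcases D.par i
  · simp only [cond_false]
    rcases D.kind i
    · exact ⟨h2.2.2, h2.1.symm, h2.2.1.symm⟩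
    · exact ⟨h2.1.symm, h2.2.2, h2.2.1⟩
  · simp only [cond_true]
    rcases D.kind (i + 1)
    · exact ⟨h1.2.1, h1.1, h1.2.2.symm⟩
    · exact h1

theorem colors_near (i : ZMod n) :
    D.colors (D.near i) = {D.c i, D.nearColor i, D.t (D.near i)} := by
  unfold colors nearColor near
  rcases D.par i
  · simp
  · exact insert_comm _ _ _

theorem colors_far (i : ZMod n) : D.colors (D.far i) = {D.c i, D.k i, D.l i} := by
  unfold colors k l farColor far
  rcases D.par i
  · simp only [cond_false]
    rcases D.kind i
    · grind
    · exact insert_comm _ _ _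
  · simp only [cond_true, add_sub_cancel_right]
    rcases D.kind (i + 1)
    · grind
    · rfl

theorem colors_side (i : ZMod n) (x : SuperedgeVertex) :
    D.colors (D.side i x) = bif isNear (D.place i x) then
      {D.c i, D.nearColor i, D.t (D.near i)} else {D.c i, D.k i, D.l i} := by
  unfold side
  rcases isNear (D.place i x)
  · exact colors_far i
  · exact colors_near i

theorem side_eq_or (i : ZMod n) (x : SuperedgeVertex) :
    D.side i x = i ∨ D.side i x = i + 1 := by
  unfold side near far
  rcases isNear (D.place i x) <;> rcases D.par i <;> simp

section Interface

variable (hpar : ∀ i, D.par (i + 1) = !D.par i)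
include hpar

/-- Across a supervertex `A`, the colors of the two superedges agree, and the edges of `A` have an
end with the colors of the superposed vertex. -/
theorem semi_of_A {i : ZMod n} (h : D.kind (i + 1) = .A) (level : Bool) :
    D.semi i (rightEnd level) = D.semi (i + 1) (leftEnd (xor level (D.twist (i + 1)))) ∧
      (D.side i (rightEnd level) = i + 1 ∨
        D.side (i + 1) (leftEnd (xor level (D.twist (i + 1)))) = i + 1) := by
  have hp := hpar i
  have hf' : D.flip (i + 1) = (!D.par i && !D.twist (i + 1)) := by simp [flip, hp, h]
  rcases hi : D.par i
  · have hf : D.flip i = false := by simp [flip, hi]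
    rcases ht : D.twist (i + 1) <;> cases level <;>
      simp [semi, side, place, near, far, nearColor, hp, hi, hf, hf', ht, twistBy, reflect,
        swapLevels, leftEnd, rightEnd, isNear, semiColor]
  · rcases hf : D.flip i <;> rcases ht : D.twist (i + 1) <;> cases level <;>
      simp [semi, side, place, k, near, far, hp, hi, hf, hf', h, twistBy, reflect,
        swapLevels, leftEnd, rightEnd, isNear, semiColor]

/-- Across a supervertex `Aprime`, the semiedges of `u'` and `u''` towards the superedges have the
two colors of the cycle at the superposed vertex. -/
theorem semi_of_Aprime {i : ZMod n} (h : D.kind (i + 1) = .Aprime) (level : Bool) :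
    (D.semi i (rightEnd level) = D.c i ∧
      D.semi (i + 1) (leftEnd (xor level (D.twist (i + 1)))) = D.c (i + 1)) ∨
    (D.semi i (rightEnd level) = D.c (i + 1) ∧
      D.semi (i + 1) (leftEnd (xor level (D.twist (i + 1)))) = D.c i) := by
  have hp := hpar i
  have hf' : D.flip (i + 1) = (!D.par i && D.twist (i + 1)) := by simp [flip, hp, h]
  rcases hi : D.par i
  · have hf : D.flip i = false := by simp [flip, hi]
    rcases ht : D.twist (i + 1) <;> cases level <;>
      simp [semi, place, nearColor, hp, hi, hf, hf', ht, twistBy, reflect, swapLevels, leftEnd,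
        rightEnd, semiColor]
  · rcases hf : D.flip i <;> rcases ht : D.twist (i + 1) <;> cases level <;>
      simp [semi, place, k, far, farColor, hp, hi, hf, hf', h, twistBy, reflect, swapLevels,
        leftEnd, rightEnd, semiColor]

end Interface

/-! ### The coloring of the superposition -/

variable {V : Type*} [DecidableEq V]

/-- The color of the edge between `ℬ_i` and the vertex `v` of the cycle. The two colors of the
cycle at every odd `u_j` are thus exchanged. -/
def spoke (D : CycleData n) (u : ZMod n → V) (i : ZMod n) (v : V) : Fin 5 :=
  if v = u (D.far i) then D.c i else D.nearColor i

/-- The coloring of the superposition that extends `σ` outside the cycle. The value `0` is taken at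
pairs that are never adjacent. -/
def color (D : CycleData n) (u : ZMod n → V) (σ : V → V → Fin 5) :
    SuperpositionVertex V n D.kind → SuperpositionVertex V n D.kind → Fin 5
  | .base v, .base w => σ v w
  | .base v, .edge i _ => D.spoke u i v
  | .base _, .mid _ _ _ => 0
  | .edge i _, .base v => D.spoke u i v
  | .edge i x, .edge j y => if i = j then D.inner i x y else D.semi i x
  | .edge i x, .mid _ _ _ => D.semi i x
  | .mid _ _ _, .base _ => 0
  | .mid _ _ _, .edge i x => D.semi i x
  | .mid i _ _, .mid _ _ _ => D.t i

/-- The vertex of `G` whose colors are used at a given vertex of the superposition. -/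
def proj (D : CycleData n) (u : ZMod n → V) : SuperpositionVertex V n D.kind → V
  | .base v => v
  | .edge i x => u (D.side i x)
  | .mid i _ _ => u i

variable {u : ZMod n → V} {σ : V → V → Fin 5} {G : SimpleGraph V}

theorem spoke_eq (hu : Function.Injective u) (hn : (1 : ZMod n) ≠ 0) (i : ZMod n) :
    (D.spoke u i (u i) = D.c i ∧ D.spoke u i (u (i + 1)) = D.nearColor i) ∨
      (D.spoke u i (u i) = D.nearColor i ∧ D.spoke u i (u (i + 1)) = D.c i) := by
  unfold spoke far
  rcases D.par i <;> simp [hu.eq_iff, hn]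

omit [DecidableEq V] in
/-- Adjacent vertices of the superposition are projected to equal or adjacent vertices of `G`. -/
theorem proj_eq_or_adj (hadj : ∀ i, G.Adj (u i) (u (i + 1)))
    (hpar : ∀ i, D.par (i + 1) = !D.par i) {x y : SuperpositionVertex V n D.kind}
    (h : SuperpositionRel G u D.kind D.twist x y) :
    D.proj u x = D.proj u y ∨ G.Adj (D.proj u x) (D.proj u y) := by
  have key : ∀ i j k, (j = i ∨ j = i + 1) → (k = i ∨ k = i + 1) →
      u j = u k ∨ G.Adj (u j) (u k) := by
    rintro i j k (rfl | rfl) (rfl | rfl)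
    · exact Or.inl rfl
    · exact Or.inr (hadj _)
    · exact Or.inr (hadj _).symm
    · exact Or.inl rfl
  cases h with
  | base hG hC => exact Or.inr hG
  | edge i h => exact key i _ _ (side_eq_or _ _) (side_eq_or _ _)
  | start i => exact key i _ _ (Or.inl rfl) (side_eq_or _ _)
  | finish i => exact key i _ _ (side_eq_or _ _) (Or.inr rfl)
  | straight i level h =>
    rcases (semi_of_A hpar h level).2 with hs | hs
    · exact key (i + 1) _ _ (Or.inl hs) (side_eq_or _ _)
    · exact key i _ _ (side_eq_or _ _) (Or.inr hs)
  | midLeft i level h => exact key i _ _ (side_eq_or _ _) (Or.inr rfl)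
  | midRight i level h => exact key i _ _ (Or.inl rfl) (side_eq_or _ _)
  | midMid i h => exact Or.inl rfl

theorem color_comm (hσ : ∀ v w, G.Adj v w → σ v w = σ w v)
    (hpar : ∀ i, D.par (i + 1) = !D.par i) (hn : (1 : ZMod n) ≠ 0)
    {x y : SuperpositionVertex V n D.kind} (h : SuperpositionRel G u D.kind D.twist x y) :
    D.color u σ x y = D.color u σ y x := by
  cases h with
  | base hG hC => exact hσ _ _ hG
  | edge i h => simp only [color, if_true]; exact innerColor_comm _ _ _ _ _ _ _
  | straight i level h => simpa [color, hn] using (semi_of_A hpar h level).1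
  | _ => rfl

theorem color_leftNeighbor (hn : (1 : ZMod n) ≠ 0) (i : ZMod n) (x : SuperedgeVertex)
    (level : Bool) :
    D.color u σ (.edge i x) (Superposition.leftNeighbor V D.kind D.twist i level) = D.semi i x := by
  rcases h : D.kind i
  · have hi : i ≠ i - 1 := fun hi => hn (by simpa using hi.symm)
    simp [Superposition.leftNeighbor_of_A h, color, hi]
  · simp [Superposition.leftNeighbor_of_Aprime h, color]

theorem color_rightNeighbor (hn : (1 : ZMod n) ≠ 0) (i : ZMod n) (x : SuperedgeVertex)
    (level : Bool) :
    D.color u σ (.edge i x) (Superposition.rightNeighbor V D.kind D.twist i level) =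
      D.semi i x := by
  rcases h : D.kind (i + 1)
  · simp [Superposition.rightNeighbor_of_A h, color, hn]
  · simp [Superposition.rightNeighbor_of_Aprime h, color]

theorem outerColors_place (i : ZMod n) (x : SuperedgeVertex) :
    outerColors (D.c i) (D.nearColor i) (D.k i) (D.place i x) = match x with
      | .a => {D.c i, D.nearColor i}
      | .b => ∅
      | .e => ∅
      | .f => ∅
      | x => {D.semi i x} := by
  unfold semi place
  rcases D.par i <;> rcases D.flip i <;> cases x <;> rfl

theorem bijOn_outerNeighbors (hD : D.IsProper) (hu : Function.Injective u)
    (hn : (1 : ZMod n) ≠ 0) (i : ZMod n) (x : SuperedgeVertex) :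
    BijOn (D.color u σ (.edge i x)) (Superposition.outerNeighbors u D.kind D.twist i x)
      (outerColors (D.c i) (D.nearColor i) (D.k i) (D.place i x)) := by
  have hleft := color_leftNeighbor (D := D) (u := u) (σ := σ) hn i
  have hright := color_rightNeighbor (D := D) (u := u) (σ := σ) hn i
  have hc := (hD.near_distinct i).1
  rw [outerColors_place]
  cases x with
  | a =>
    rcases spoke_eq (D := D) hu hn i with ⟨h1, h2⟩ | ⟨h1, h2⟩
    · exact bijOn_pair h1 h2 hc
    · rw [pair_comm (D.c i)]
      exact bijOn_pair h1 h2 hc.symm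
  | b => exact bijOn_empty _
  | e => exact bijOn_empty _
  | f => exact bijOn_empty _
  | c => exact bijOn_singleton.2 (hleft _ _)
  | g => exact bijOn_singleton.2 (hleft _ _)
  | d => exact bijOn_singleton.2 (hright _ _)
  | h => exact bijOn_singleton.2 (hright _ _)

theorem bijOn_color_edge (hD : D.IsProper) (hu : Function.Injective u)
    (hn : (1 : ZMod n) ≠ 0) (i : ZMod n) (x : SuperedgeVertex) :
    BijOn (D.color u σ (.edge i x))
      ((superposition G u D.kind D.twist).neighborSet (.edge i x)) (D.colors (D.side i x)) := by
  have hnear := hD.near_distinct i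
  have hfar := hD.far_distinct i
  have hout := bijOn_outerNeighbors (σ := σ) hD hu hn i x
  have hin := bijOn_innerColor_twistBy hnear.1 hnear.2.1 hnear.2.2 hfar.1 hfar.2.1 hfar.2.2
    (D.par i) (D.flip i) x
  rw [Superposition.neighborSet_edge, colors_side]
  have hsub : outerColors (D.c i) (D.nearColor i) (D.k i) (D.place i x) ⊆
      (bif isNear (D.place i x) then {D.c i, D.nearColor i, D.t (D.near i)}
        else {D.c i, D.k i, D.l i}) := by
    generalize D.place i x = v
    cases v <;> simp [outerColors, isNear, semiColor, insert_subset_iff]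
  have hin' : BijOn (D.color u σ (.edge i x)) (.edge i '' superedgeB.neighborSet x)
      ((bif isNear (D.place i x) then {D.c i, D.nearColor i, D.t (D.near i)}
        else {D.c i, D.k i, D.l i}) \
          outerColors (D.c i) (D.nearColor i) (D.k i) (D.place i x)) := by
    have hinj : InjOn (SuperpositionVertex.edge (V := V) (kind := D.kind) i)
        (superedgeB.neighborSet x) := fun y _ z _ h => (SuperpositionVertex.edge.inj h).2
    rw [← bijOn_comp_iff hinj]
    refine hin.congr fun y _ => ?_
    simp [color, inner, place]
  have hne : ∀ y ∈ SuperpositionVertex.edge i '' superedgeB.neighborSet x,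
      ∀ z ∈ Superposition.outerNeighbors u D.kind D.twist i x,
        D.color u σ (.edge i x) y ≠ D.color u σ (.edge i x) z :=
    fun y hy z hz h => (hin'.mapsTo hy).2 (h ▸ hout.mapsTo hz)
  rw [← sdiff_union_of_subset hsub]
  exact hin'.union hout ((injOn_union (disjoint_left.2 fun y hy hz => hne y hy y hz rfl)).2
    ⟨hin'.injOn, hout.injOn, hne⟩)

theorem bijOn_color_mid (hD : D.IsProper) (hpar : ∀ i, D.par (i + 1) = !D.par i) (i : ZMod n)
    (level : Bool) (h : D.kind i = .Aprime) :
    BijOn (D.color u σ (.mid i level h))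
      ((superposition G u D.kind D.twist).neighborSet (.mid i level h)) (D.colors i) := by
  obtain ⟨j, rfl⟩ : ∃ j, i = j + 1 := ⟨i - 1, by simp⟩
  have hd := hD j
  rw [Superposition.neighborSet_mid, colors, add_sub_cancel_right]
  rcases semi_of_Aprime hpar h level with ⟨h1, h2⟩ | ⟨h1, h2⟩
  · exact bijOn_triple h1 h2 rfl hd.1 hd.2.1 hd.2.2
  · rw [insert_comm (D.c j)]
    exact bijOn_triple h1 h2 rfl hd.1.symm hd.2.2 hd.2.1

/-- The two spokes at a vertex of the cycle use the two colors of the cycle there. -/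
theorem spoke_cycle (hu : Function.Injective u) (hpar : ∀ i, D.par (i + 1) = !D.par i)
    (hn : (1 : ZMod n) ≠ 0) (i : ZMod n) :
    (D.spoke u i (u (i + 1)) = D.c i ∧ D.spoke u (i + 1) (u (i + 1)) = D.c (i + 1)) ∨
      (D.spoke u i (u (i + 1)) = D.c (i + 1) ∧ D.spoke u (i + 1) (u (i + 1)) = D.c i) := by
  have hp := hpar i
  rcases hi : D.par i <;> simp [spoke, far, nearColor, hp, hi, hu.eq_iff, hn]

variable {S : V → Finset (Fin 5)}

theorem normalLabelling_color (hσ : NormalLabelling G σ S) (hu : Function.Injective u)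
    (hadj : ∀ i, G.Adj (u i) (u (i + 1))) (hpar : ∀ i, D.par (i + 1) = !D.par i)
    (hn : (1 : ZMod n) ≠ 0) (hD : D.IsProper) (hS : ∀ i, D.colors i = S (u i)) (w : ZMod n → V)
    (hw : ∀ i, w (i + 1) ≠ u i ∧ w (i + 1) ≠ u (i + 1 + 1) ∧
      G.neighborSet (u (i + 1)) = {u i, u (i + 1 + 1), w (i + 1)})
    (ht : ∀ i, D.t i = σ (u i) (w i)) :
    NormalLabelling (superposition G u D.kind D.twist) (D.color u σ) (fun x => S (D.proj u x)) where
  symm x y h := by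
    rcases Superposition.adj_iff.1 h with h | h
    · exact color_comm hσ.symm hpar hn h
    · exact (color_comm hσ.symm hpar hn h).symm
  card x := hσ.card _
  normal x y h := by
    have key : ∀ {x y}, SuperpositionRel G u D.kind D.twist x y →
        S (D.proj u x) = S (D.proj u y) ∨ (S (D.proj u x) ∪ S (D.proj u y)).card = 5 := by
      intro x y h
      rcases proj_eq_or_adj hadj hpar h with h | h
      · exact Or.inl (congrArg S h)
      · exact hσ.normal _ _ h
    rcases Superposition.adj_iff.1 h with h | h
    · exact key h
    · exact (key h).imp Eq.symm fun h => by rw [Finset.union_comm, h]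
  bijOn x := by
    cases x with
    | edge i x =>
      simp only [proj, ← hS]
      exact bijOn_color_edge hD hu hn i x
    | mid i level h =>
      simp only [proj, ← hS]
      exact bijOn_color_mid hD hpar i level h
    | base v =>
      by_cases hv : v ∈ range u
      · obtain ⟨i, rfl⟩ := hv
        obtain ⟨j, rfl⟩ : ∃ j, i = j + 1 := ⟨i - 1, by simp⟩
        have hd := hD j
        simp only [proj, ← hS, colors, add_sub_cancel_right]
        rw [Superposition.neighborSet_base_cycle hu j (hw j).2.2 (hw j).1 (hw j).2.1]
        rcases spoke_cycle hu hpar hn j with ⟨h1, h2⟩ | ⟨h1, h2⟩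
        · exact bijOn_triple h1 h2 (ht _).symm hd.1 hd.2.1 hd.2.2
        · rw [insert_comm (D.c j)]
          exact bijOn_triple h1 h2 (ht _).symm hd.1.symm hd.2.2 hd.2.1
      · rw [Superposition.neighborSet_base_of_notMem hv, ← bijOn_comp_iff
          (fun y _ z _ h => SuperpositionVertex.base.inj h)]
        exact hσ.bijOn v

end CycleData

/-! ### Poor edges in the superedges -/

/-- For `p = (i, j)`, the edge of `ℬ_i` whose image under the involution `place i` is the `j`-th edge
within a side of `B`. -/
def CycleData.poorEdge {n : ℕ} (D : CycleData n) {V : Type*} (p : ZMod n × Fin 6) :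
    Sym2 (SuperpositionVertex V n D.kind) :=
  s(.edge p.1 (D.place p.1 (sideEdge p.2).1), .edge p.1 (D.place p.1 (sideEdge p.2).2))

theorem CycleData.poorEdge_injective {n : ℕ} (D : CycleData n) {V : Type*} :
    Function.Injective (D.poorEdge (V := V)) := by
  rintro ⟨i, p⟩ ⟨j, q⟩ h
  obtain rfl : i = j := by
    rcases Sym2.eq_iff.1 h with h | h <;> exact (SuperpositionVertex.edge.inj h.1).1
  have hinj : Function.Injective fun x => SuperpositionVertex.edge (V := V) (kind := D.kind) i
      (D.place i x) := fun x y hxy =>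
    (Function.LeftInverse.injective (twistBy_twistBy (D.par i) (D.flip i)))
      (SuperpositionVertex.edge.inj hxy).2
  have h' : Sym2.map (fun x => SuperpositionVertex.edge (V := V) (kind := D.kind) i (D.place i x))
      s((sideEdge p).1, (sideEdge p).2) = Sym2.map (fun x => .edge i (D.place i x))
      s((sideEdge q).1, (sideEdge q).2) := h
  exact congrArg (Prod.mk i) (sideEdge_injective (Sym2.map.injective hinj h'))

instance {V : Type*} [Finite V] {n : ℕ} [NeZero n] (kind : ZMod n → SupervertexKind) :
    Finite (SuperpositionVertex V n kind) := by
  let f : SuperpositionVertex V n kind → V ⊕ (ZMod n × SuperedgeVertex) ⊕ (ZMod n × Bool) :=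
    fun x => match x with
      | .base v => .inl v
      | .edge i x => .inr (.inl (i, x))
      | .mid i level _ => .inr (.inr (i, level))
  refine Finite.of_injective f ?_
  rintro (v | ⟨i, x⟩ | ⟨i, l, h⟩) (w | ⟨j, y⟩ | ⟨j, m, h'⟩) hxy <;> simp_all [f]

/-! ### Superpositions of normally colored graphs -/

theorem exists_third {α : Type*} {s : Set α} (hs : s.ncard = 3) {p q : α} (hp : p ∈ s)
    (hq : q ∈ s) (hpq : p ≠ q) : ∃ w, w ≠ p ∧ w ≠ q ∧ s = {p, q, w} := by
  obtain ⟨x, y, z, hxy, hxz, hyz, rfl⟩ := ncard_eq_three.1 hs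
  obtain ⟨w, hw, h1, h2⟩ : ∃ w, (w = x ∨ w = y ∨ w = z) ∧ w ≠ p ∧ w ≠ q := by
    by_contra! h
    have hx := h x
    have hy := h y
    have hz := h z
    grind
  refine ⟨w, h1, h2, ?_⟩
  ext v
  grind

/-- A normal coloring of `G` yields one of every superposition along an even cycle, with at least
six poor edges in each superedge. -/
theorem exists_isNormal_superposition {V : Type*} [Finite V] {G : SimpleGraph V}
    {σ : V → V → Fin 5} {S : V → Finset (Fin 5)} (hσ : NormalLabelling G σ S) {n : ℕ}
    (hn : 3 ≤ n) (heven : Even n) {u : ZMod n → V} (hu : Function.Injective u)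
    (hadj : ∀ i, G.Adj (u i) (u (i + 1))) (kind : ZMod n → SupervertexKind)
    (twist : ZMod n → Bool) :
    ∃ τ : ProperEdgeColoring (superposition G u kind twist) 5,
      τ.IsNormal ∧ 6 * n ≤ {e | τ.IsPoor e}.ncard := by
  classical
  have : NeZero n := ⟨by omega⟩
  have h1 : (1 : ZMod n) ≠ 0 := by
    have := (ZMod.natCast_eq_zero_iff 1 n).not.2 (Nat.not_dvd_of_pos_of_lt one_pos (by omega))
    simpa using this
  have h2 : (1 + 1 : ZMod n) ≠ 0 := by
    have := (ZMod.natCast_eq_zero_iff 2 n).not.2 (Nat.not_dvd_of_pos_of_lt two_pos (by omega))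
    rw [one_add_one_eq_two]
    exact_mod_cast this
  have hu2 : ∀ i, u i ≠ u (i + 1 + 1) := by
    intro i h
    have := hu h
    rw [add_assoc] at this
    exact h2 (by simpa using this.symm)
  have hN : ∀ v, (G.neighborSet v).ncard = 3 := by
    intro v
    rw [← (hσ.bijOn v).injOn.ncard_image, (hσ.bijOn v).image_eq, ncard_coe_finset,
      hσ.card]
  have hw : ∀ i, ∃ w, w ≠ u (i - 1) ∧ w ≠ u (i + 1) ∧
      G.neighborSet (u i) = {u (i - 1), u (i + 1), w} := by
    intro i
    refine exists_third (hN _) ?_ (hadj i) ?_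
    · simpa using (hadj (i - 1)).symm
    · simpa using hu2 (i - 1)
  choose w hw using hw
  have hw' : ∀ i, w (i + 1) ≠ u i ∧ w (i + 1) ≠ u (i + 1 + 1) ∧
      G.neighborSet (u (i + 1)) = {u i, u (i + 1 + 1), w (i + 1)} := by
    intro i
    simpa using hw (i + 1)
  -- Parity is well defined modulo `n` because `n` is even.
  let par : ZMod n → Bool := fun i => ZMod.castHom heven.two_dvd (ZMod 2) i = 1
  let D : CycleData n := ⟨fun i => σ (u i) (u (i + 1)), fun i => σ (u i) (w i), par, kind, twist⟩
  have hpar : ∀ i, D.par (i + 1) = !D.par i := by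
    intro i
    simp only [D, par, map_add, map_one]
    generalize (ZMod.castHom heven.two_dvd (ZMod 2)) i = z
    revert z
    decide
  have hc : ∀ i, D.c i = σ (u (i + 1)) (u i) := fun i => hσ.symm _ _ (hadj i)
  have hwadj : ∀ i, G.Adj (u i) (w i) := by
    intro i
    have : w i ∈ G.neighborSet (u i) := by rw [(hw i).2.2]; simp
    exact this
  have hD : D.IsProper := by
    intro i
    have hinj := (hσ.bijOn (u (i + 1))).injOn
    rw [hc i]
    exact ⟨hinj.ne (hadj i).symm (hadj (i + 1)) (hu2 i),
      hinj.ne (hadj i).symm (hwadj (i + 1)) (hw' i).1.symm,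
      hinj.ne (hadj (i + 1)) (hwadj (i + 1)) (hw' i).2.1.symm⟩
  have hS : ∀ i, D.colors i = S (u i) := by
    intro i
    rw [← (hσ.bijOn (u i)).image_eq, (hw i).2.2, image_insert_eq, image_pair]
    have := hc (i - 1)
    rw [sub_add_cancel] at this
    rw [CycleData.colors, this]
  have hlab := CycleData.normalLabelling_color hσ hu hadj hpar h1 hD hS w hw' fun _ => rfl
  obtain ⟨τ, hτ, hpoor⟩ := hlab.exists_coloring
  refine ⟨τ, hτ, ?_⟩
  have hp : ∀ p : ZMod n × Fin 6, ∃ e : (superposition G u kind twist).edgeSet,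
      τ.IsPoor e ∧ e.1 = D.poorEdge p := by
    rintro ⟨i, j⟩
    have hadj' : (superposition G u kind twist).Adj (.edge i (D.place i (sideEdge j).1))
        (.edge i (D.place i (sideEdge j).2)) :=
      Superposition.adj_iff.2 (Or.inl (.edge i ((twistBy_adj _ _ _ _).2 (sideEdge_adj j))))
    refine ⟨⟨_, hadj'⟩, hpoor _ _ hadj' ?_, rfl⟩
    simp only [CycleData.proj, CycleData.side, CycleData.place, twistBy_twistBy, isNear_sideEdge]
  choose e he he' using hp
  have hinj : Function.Injective e := fun p q h =>
    D.poorEdge_injective (V := V) (by rw [← he', ← he', h])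
  calc 6 * n = (range e).ncard := by
        rw [← image_univ, ncard_image_of_injective _ hinj, ncard_univ, Nat.card_prod,
          Nat.card_zmod, Nat.card_eq_fintype_card, Fintype.card_fin, mul_comm]
    _ ≤ _ := ncard_le_ncard (range_subset_iff.2 he) (toFinite _)

theorem cycleVertex_injective {V : Type*} {G : SimpleGraph V} {v : V} {C : G.Walk v v}
    (hC : C.IsCycle) : Function.Injective (cycleVertex C) := by
  have h3 := hC.three_le_length
  have : NeZero C.length := ⟨by omega⟩
  intro i j hij
  have hi := ZMod.val_lt i
  have hj := ZMod.val_lt j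
  refine ZMod.val_injective _ (hC.getVert_injOn' ?_ ?_ hij)
  · simp only [mem_ofPred_eq]; omega
  · simp only [mem_ofPred_eq]; omega

theorem adj_cycleVertex {V : Type*} {G : SimpleGraph V} {v : V} {C : G.Walk v v}
    (hC : C.IsCycle) (i : ZMod C.length) :
    G.Adj (cycleVertex C i) (cycleVertex C (i + 1)) := by
  have h3 := hC.three_le_length
  have : NeZero C.length := ⟨by omega⟩
  have hi := ZMod.val_lt i
  have hadj := C.adj_getVert_succ hi
  have h1 : (1 : ZMod C.length).val = 1 := ZMod.val_one'' (by omega)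
  unfold cycleVertex
  rw [ZMod.val_add, h1]
  rcases (Nat.succ_le_of_lt hi).lt_or_eq with h | h
  · rwa [Nat.mod_eq_of_lt h]
  · have h' : i.val + 1 = C.length := h
    rw [h', SimpleGraph.Walk.getVert_length] at hadj
    rwa [h', Nat.mod_self, SimpleGraph.Walk.getVert_zero]

theorem mainTheorem2 {V : Type*} [Fintype V] (G : SimpleGraph V) [DecidableRel G.Adj]
    (hG : IsSnark G)
    (hσ : ∃ σ : ProperEdgeColoring G 5, σ.IsNormal)
    {v : V} (C : G.Walk v v) (hC : C.IsCycle) (heven : Even C.length)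
    (kind : ZMod C.length → SupervertexKind) (twist : ZMod C.length → Bool) :
    ∃ τ : ProperEdgeColoring (superposition G (cycleVertex C) kind twist) 5,
      τ.IsNormal ∧ 18 ≤ {e | τ.IsPoor e}.ncard := by
  obtain ⟨σ, hσ⟩ := hσ
  obtain ⟨f, S, hf⟩ := exists_normalLabelling hG.cubic σ hσ
  have h3 := hC.three_le_length
  obtain ⟨τ, hτ, hpoor⟩ := exists_isNormal_superposition hf h3 heven (cycleVertex_injective hC)
    (adj_cycleVertex hC) kind twist
  exact ⟨τ, hτ, by omega⟩
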